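/- Let $0<a_1\le\dots\le a_n$ ($n\ge 1$) be real numbers and $A=\mathrm{diag}(a_1,\dots,a_n)$. Let $\lambda_1<\dots<\lambda_k$ be the distinct values among $a_1,\dots,a_n$ and $\ell_1,\dots,\ell_k$ their multiplicities, so that $\mathbb C^n=\mathbb C^{\ell_1}\oplus\dots\oplus\mathbb C^{\ell_k}$ is the decomposition into the eigenspaces of $A$. Consider the complex ellipsoid $$E(A)=\Big\{z\in\mathbb C^n \;\Big|\; \tfrac{|z_1|^2}{a_1}+\dots+\tfrac{|z_n|^2}{a_n}=1\Big\}$$ with the magnetic system $(E(A),g,\mathrm d\alpha)$, where $g=\mathrm{Re}\langle\cdot,\cdot\rangle$ is the restriction of the Euclidean metric and $\alpha_z=\tfrac12\,\mathrm{Im}\langle z,\cdot\rangle$ (the Hermitian product $\langle\cdot,\cdot\rangle$ being conjugate-linear in the first argument). A magnetic geodesic of a magnetic system $(M,g,\sigma)$ is a smooth curve $\gamma$ in $M$ with $\nabla_{\dot\gamma}\dot\gamma=Y_\gamma\dot\gamma$, where $\nabla$ is the Levi-Civita connection of $g$ and $g(Yu,v)=\sigma(u,v)$. An embedded submanifold $N\subseteq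 M$ is called totally magnetic if for every magnetic geodesic $\gamma:I\to M$, $I$ an open interval containing $0$, with $\gamma(0)\in N$ and $\dot\gamma(0)\in T_{\gamma(0)}N$, there is $\varepsilon>0$ such that $\gamma((-\varepsilon,\varepsilon))\subseteq N$. Let $V_1\subseteq\mathbb C^{\ell_1},\dots,V_k\subseteq\mathbb C^{\ell_k}$ be complex linear subspaces. Then $E(A)\cap(V_1\oplus\dots\oplus V_k)$ is a totally magnetic submanifold of $(E(A),g,\mathrm d\alpha)$. (The empty set, which occurs exactly if all $V_j$ are zero, counts as a submanifold.) -/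

import Mathlib

open Set Filter Topology
open scoped ContDiff

noncomputable section

section Submanifolds

/-- `φ`, restricted to the open set `U ⊆ ℝ^d`, is a smooth local parametrization of the subset `M`
of the vector space `E`: a smooth immersion of `U` which is a homeomorphism onto a relatively open
subset of `M`. -/
structure IsLocalParametrization {E : Type*} [NormedAddCommGroup E] [NormedSpace ℝ E] {d : ℕ}
    (M : Set E) (U : Set (EuclideanSpace ℝ (Fin d))) (φ : EuclideanSpace ℝ (Fin d) → E) : Prop where
  isOpen : IsOpen U
  smooth : ContDiffOn ℝ ∞ φ U
  immersion : ∀ x ∈ U, Function.Injective (fderiv ℝ φ x)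
  isEmbedding : IsEmbedding (U.domRestrict φ)
  relOpen : ∃ O : Set E, IsOpen O ∧ φ '' U = M ∩ O

/-- `M ⊆ E` is a `d`-dimensional smooth embedded submanifold of `E`
(the empty set is one for every `d`). -/
def IsEmbeddedSubmanifold {E : Type*} [NormedAddCommGroup E] [NormedSpace ℝ E] (d : ℕ)
    (M : Set E) : Prop :=
  ∀ p ∈ M, ∃ (U : Set (EuclideanSpace ℝ (Fin d))) (φ : EuclideanSpace ℝ (Fin d) → E),
    IsLocalParametrization M U φ ∧ p ∈ φ '' U

/-- The tangent space `T_p N`: the velocities at `p` of the smooth curves in `N` through `p`. -/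
def tangentVectors {E : Type*} [NormedAddCommGroup E] [NormedSpace ℝ E] (N : Set E) (p : E) :
    Set E :=
  {v | ∃ (c : ℝ → E) (ε : ℝ), 0 < ε ∧ ContDiffOn ℝ ∞ c (Ioo (-ε) ε) ∧
    (∀ t ∈ Ioo (-ε) ε, c t ∈ N) ∧ c 0 = p ∧ deriv c 0 = v}

end Submanifolds

section LocalCoordinates

/-- The pullback `φ^* g` of a field `g` of bilinear forms: the metric tensor in the
coordinates given by `φ`. -/
def pullbackMetric {E F : Type*} [NormedAddCommGroup E] [NormedSpace ℝ E]
    [NormedAddCommGroup F] [NormedSpace ℝ F] (φ : F → E) (g : E → E →L[ℝ] E →L[ℝ] ℝ) :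
    F → F →L[ℝ] F →L[ℝ] ℝ :=
  fun x => (g (φ x)).bilinearComp (fderiv ℝ φ x) (fderiv ℝ φ x)

/-- The pullback `φ^* σ` of a differential two-form. -/
def pullbackTwoForm {E F : Type*} [NormedAddCommGroup E] [NormedSpace ℝ E]
    [NormedAddCommGroup F] [NormedSpace ℝ F] (φ : F → E) (σ : E → E [⋀^Fin 2]→L[ℝ] ℝ) :
    F → F [⋀^Fin 2]→L[ℝ] ℝ :=
  fun x => (σ (φ x)).compContinuousLinearMap (fderiv ℝ φ x)

/-- The Christoffel symbols of the first kind of a metric `h` on an open subset of a vector space,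
`Γ_x(u, v; w) = ½ (∂_u h(v, w) + ∂_v h(u, w) - ∂_w h(u, v))`. -/
def christoffel {F : Type*} [NormedAddCommGroup F] [NormedSpace ℝ F]
    (h : F → F →L[ℝ] F →L[ℝ] ℝ) (x u v w : F) : ℝ :=
  (1 / 2 : ℝ) * (fderiv ℝ (fun y => h y v w) x u + fderiv ℝ (fun y => h y u w) x v
    - fderiv ℝ (fun y => h y u v) x w)

/-- The number `h(∇_{ẋ} ẋ, w)` at time `t`, where `∇` is the Levi-Civita connection of the metric
`h` on an open subset of a vector space: in coordinates, `h_x(ẍ, w) + Γ_x(ẋ, ẋ; w)`. -/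
def lowerCovariantAcceleration {F : Type*} [NormedAddCommGroup F] [NormedSpace ℝ F]
    (h : F → F →L[ℝ] F →L[ℝ] ℝ) (x : ℝ → F) (t : ℝ) (w : F) : ℝ :=
  h (x t) (deriv (deriv x) t) w + christoffel h (x t) (deriv x t) (deriv x t) w

end LocalCoordinates

section MagneticSystems

/-- `(M, g|_M, σ|_M)` is a magnetic system: `M` is a closed (that is, compact and without boundary)
connected submanifold of `E`, the bilinear forms `g` restrict to a Riemannian metric on `M`,
and `σ` is a closed two-form. -/
structure IsMagneticSystem {E : Type*} [NormedAddCommGroup E] [NormedSpace ℝ E] (M : Set E)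
    (g : E → E →L[ℝ] E →L[ℝ] ℝ) (σ : E → E [⋀^Fin 2]→L[ℝ] ℝ) : Prop where
  submanifold : ∃ d : ℕ, IsEmbeddedSubmanifold d M
  compact : IsCompact M
  connected : IsConnected M
  metric_smooth : ContDiff ℝ ∞ g
  metric_symm : ∀ p u v, g p u v = g p v u
  metric_pos : ∀ p ∈ M, ∀ v ∈ tangentVectors M p, v ≠ 0 → 0 < g p v v
  form_smooth : ContDiff ℝ ∞ σ
  form_closed : ∀ p, extDeriv σ p = 0

/-- The curve `γ : I → M` is a magnetic geodesic of `(M, g|_M, σ|_M)`, that is, a smooth curve with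
`∇_{γ̇} γ̇ = Y γ̇`, where `∇` is the Levi-Civita connection of the metric `g|_M` on `M` and the
Lorentz force `Y` is determined by `g(Y u, v) = σ(u, v)`. The equation, paired with an
arbitrary tangent vector `w`, is read in local coordinates of `M` around each point of `γ`;
`x` is the coordinate expression of `γ`. -/
structure IsMagneticGeodesic {E : Type*} [NormedAddCommGroup E] [NormedSpace ℝ E] (M : Set E)
    (g : E → E →L[ℝ] E →L[ℝ] ℝ) (σ : E → E [⋀^Fin 2]→L[ℝ] ℝ) (I : Set ℝ) (γ : ℝ → E) :
    Prop where
  smooth : ContDiffOn ℝ ∞ γ I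
  mapsTo : MapsTo γ I M
  equation : ∀ t₀ ∈ I, ∃ (d : ℕ) (U : Set (EuclideanSpace ℝ (Fin d)))
    (φ : EuclideanSpace ℝ (Fin d) → E) (J : Set ℝ) (x : ℝ → EuclideanSpace ℝ (Fin d)),
    IsLocalParametrization M U φ ∧ IsOpen J ∧ t₀ ∈ J ∧ J ⊆ I ∧ ContDiffOn ℝ ∞ x J ∧
    (∀ t ∈ J, x t ∈ U ∧ φ (x t) = γ t) ∧
    ∀ t ∈ J, ∀ w : EuclideanSpace ℝ (Fin d),
      lowerCovariantAcceleration (pullbackMetric φ g) x t w =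
        pullbackTwoForm φ σ (x t) ![deriv x t, w]

/-- `N` is a totally magnetic submanifold of the magnetic system `(M, g|_M, σ|_M)`: an embedded
submanifold `N ⊆ M` such that every magnetic geodesic of `M` which starts in `N`, with initial
velocity tangent to `N`, stays in `N` for a short time. (As `M` is an embedded submanifold of `E`,
a subset of `M` is an embedded submanifold of `M` iff it is one of `E`.) -/
structure IsTotallyMagnetic {E : Type*} [NormedAddCommGroup E] [NormedSpace ℝ E] (M : Set E)
    (g : E → E →L[ℝ] E →L[ℝ] ℝ) (σ : E → E [⋀^Fin 2]→L[ℝ] ℝ) (N : Set E) : Prop where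
  system : IsMagneticSystem M g σ
  subset : N ⊆ M
  submanifold : ∃ d : ℕ, IsEmbeddedSubmanifold d N
  invariant : ∀ (I : Set ℝ) (γ : ℝ → E), IsOpen I → I.OrdConnected → (0 : ℝ) ∈ I →
    IsMagneticGeodesic M g σ I γ → γ 0 ∈ N → deriv γ 0 ∈ tangentVectors N (γ 0) →
    ∃ ε : ℝ, 0 < ε ∧ Ioo (-ε) ε ⊆ I ∧ ∀ t ∈ Ioo (-ε) ε, γ t ∈ N

end MagneticSystems

section Ellipsoids

/-- The complex ellipsoid `E(A) ⊆ ℂⁿ`, `A = diag(a₁, …, aₙ)`. -/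
def ellipsoid {n : ℕ} (a : Fin n → ℝ) : Set (EuclideanSpace ℂ (Fin n)) :=
  {z | ∑ i, ‖z i‖ ^ 2 / a i = 1}

/-- The Euclidean metric `g = Re ⟨·,·⟩` on `ℂⁿ`. -/
def euclideanMetric (n : ℕ) : EuclideanSpace ℂ (Fin n) →
    EuclideanSpace ℂ (Fin n) →L[ℝ] EuclideanSpace ℂ (Fin n) →L[ℝ] ℝ :=
  fun _ => LinearMap.mkContinuous₂
    (LinearMap.mk₂ ℝ (fun u v : EuclideanSpace ℂ (Fin n) => (inner ℂ u v).re)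
      (by intro u u' v; simp)
      (by intro c u v; simp [inner_smul_left_eq_smul])
      (by intro u v v'; simp)
      (by intro c u v; simp [inner_smul_right_eq_smul])) 1
    (by
      intro u v
      simpa using (Complex.abs_re_le_norm _).trans (norm_inner_le_norm (𝕜 := ℂ) u v))

/-- The magnetic potential `α_z(v) = ½ Im ⟨z, v⟩ = ½ Re ⟨i z, v⟩` on `ℂⁿ`; the Hermitian product
is conjugate-linear in the first argument. -/
def magneticPotential (n : ℕ) : EuclideanSpace ℂ (Fin n) →
    EuclideanSpace ℂ (Fin n) [⋀^Fin 1]→L[ℝ] ℝ :=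
  fun z => ContinuousAlternatingMap.ofSubsingleton ℝ (EuclideanSpace ℂ (Fin n)) ℝ (0 : Fin 1)
    ((1 / 2 : ℝ) • Complex.imCLM.comp ((innerSL ℂ z).restrictScalars ℝ))

/-- The magnetic field `dα` on `ℂⁿ`. -/
def magneticField (n : ℕ) : EuclideanSpace ℂ (Fin n) →
    EuclideanSpace ℂ (Fin n) [⋀^Fin 2]→L[ℝ] ℝ :=
  fun z => extDeriv (magneticPotential n) z

/-- The block of those coordinates `z_i` of `z ∈ ℂⁿ` with `a_i = c`, in increasing order of `i`,
as a vector in `ℂ^ℓ`, where `ℓ` is the number of such indices. -/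
def coordBlock {n : ℕ} (a : Fin n → ℝ) (c : ℝ) {l : ℕ}
    (hl : (Finset.univ.filter fun i => a i = c).card = l) (z : EuclideanSpace ℂ (Fin n)) :
    EuclideanSpace ℂ (Fin l) :=
  WithLp.toLp 2 fun m => z ((Finset.univ.filter fun i => a i = c).orderEmbOfFin hl m)

/-- The subset `V₁ ⊕ ⋯ ⊕ V_k` of `ℂⁿ = ℂ^{ℓ₁} ⊕ ⋯ ⊕ ℂ^{ℓ_k}`, where the `j`-th summand of `ℂⁿ` is
the eigenspace of `A = diag(a₁, …, aₙ)` for the eigenvalue `λ_j`. -/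
def blockSum {n k : ℕ} (a : Fin n → ℝ) (lam : Fin k → ℝ) {l : Fin k → ℕ}
    (hl : ∀ j, (Finset.univ.filter fun i => a i = lam j).card = l j)
    (V : (j : Fin k) → Submodule ℂ (EuclideanSpace ℂ (Fin (l j)))) :
    Set (EuclideanSpace ℂ (Fin n)) :=
  {z | ∀ j, coordBlock a (lam j) (hl j) z ∈ V j}

end Ellipsoids

end

/-! The normal of the ellipsoid at `z` is `A⁻¹ z`, and `dα = Im ⟨·,·⟩ = Re ⟨i·,·⟩`, so the Lorentz
force is the tangential part of multiplication by `i`. A magnetic geodesic therefore satisfies `γ̈ =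
i γ̇ + μ A⁻¹ γ` with a continuous real function `μ` (`IsMagneticGeodesic.deriv_deriv_eq`).

Let `f` be a complex linear functional that factors through the block of `λ_j` and vanishes on
`V_j`. Since `f ∘ A⁻¹ = λ_j⁻¹ f`, the function `y = f ∘ γ` solves `y'' = i y' + (μ/λ_j) y`. Once `γ`
is fixed, `μ` is a given function of time, so this equation is linear; tangency at time `0` gives
`y(0) = y'(0) = 0`, hence `y = 0` (`IsMagneticGeodesic.eigenfunctional_eq_zero`). Such functionals
cut out `V_j`, so `γ` stays in the sum of the `V_j`. Complex linearity is what makes `f` commute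
with `i`.

The section is a submanifold because `√A` carries the unit sphere to the ellipsoid, which makes
every linear section a linear image of a unit sphere. -/

/-! ### Linear images of spheres as submanifolds -/

/-- Splitting off a unit vector: isometric coordinates on its orthogonal complement. -/
theorem exists_coordinates_orthogonal_complement {F : Type*} [NormedAddCommGroup F]
    [InnerProductSpace ℝ F] {d : ℕ} (hd : Module.finrank ℝ F = d + 1) (p : F) (hp : ‖p‖ = 1) :
    ∃ (j : EuclideanSpace ℝ (Fin d) →L[ℝ] F) (P : F →L[ℝ] EuclideanSpace ℝ (Fin d)),
      (∀ x, ‖j x‖ = ‖x‖) ∧ (∀ x, inner ℝ p (j x) = 0) ∧ (∀ x, P (j x) = x) ∧ P p = 0 ∧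
      ∀ z, j (P z) + inner ℝ p z • p = z := by
  have : Fact (Module.finrank ℝ F = d + 1) := ⟨hd⟩
  have : FiniteDimensional ℝ F := Module.finite_of_finrank_eq_succ hd
  have hp0 : p ≠ 0 := by rintro rfl; simp at hp
  let e := (OrthonormalBasis.fromOrthogonalSpanSingleton (𝕜 := ℝ) d hp0).repr
  let H := (Submodule.span ℝ {p})ᗮ
  refine ⟨H.subtypeL.comp (e.symm.toContinuousLinearEquiv : _ →L[ℝ] _),
    (e.toContinuousLinearEquiv : _ →L[ℝ] _).comp H.orthogonalProjectionOnto, ?_, ?_, ?_, ?_, ?_⟩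
  · intro x
    exact (Submodule.coe_norm _).symm.trans (e.symm.norm_map x)
  · intro x
    exact Submodule.mem_orthogonal_singleton_iff_inner_right.1 (e.symm x).2
  · intro x
    simp
  · have : H.orthogonalProjectionOnto p = 0 := by
      rw [Submodule.orthogonalProjectionOnto_eq_zero_iff]
      exact Submodule.le_orthogonal_orthogonal _ (Submodule.mem_span_singleton_self p)
    simp [this]
  · intro z
    have h := (Submodule.span ℝ {p}).starProjection_add_starProjection_orthogonal z
    rw [Submodule.starProjection_unit_singleton ℝ hp, add_comm] at h
    simpa [H] using h

/-- An injective linear image of the unit sphere of a Euclidean space is an embedded submanifold. -/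
theorem isEmbeddedSubmanifold_image_sphere {E F : Type*} [NormedAddCommGroup E] [NormedSpace ℝ E]
    [NormedAddCommGroup F] [InnerProductSpace ℝ F] {d : ℕ} (hd : Module.finrank ℝ F = d + 1)
    (L : F →L[ℝ] E) (R : E →L[ℝ] F) (hRL : ∀ x, R (L x) = x) :
    IsEmbeddedSubmanifold d (L '' Metric.sphere 0 1) := by
  rintro _ ⟨p, hp, rfl⟩
  have hp1 : ‖p‖ = 1 := by simpa using hp
  obtain ⟨j, P, hj, hpj, hPj, hPp, hz⟩ := exists_coordinates_orthogonal_complement hd p hp1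
  -- The open hemisphere around `p`, as a graph over the equatorial disc. The linear map `P ∘ R`
  -- inverts it, which yields both the immersion and the embedding property.
  set φ : EuclideanSpace ℝ (Fin d) → E := fun x => L (j x + √(1 - ‖x‖ ^ 2) • p) with hφ
  set U : Set (EuclideanSpace ℝ (Fin d)) := Metric.ball 0 1
  have hpp : inner ℝ p p = (1 : ℝ) := by simp [hp1]
  have hnormsq : ∀ x (c : ℝ), ‖j x + c • p‖ ^ 2 = ‖x‖ ^ 2 + c ^ 2 := by
    intro x c
    rw [norm_add_sq_real, inner_smul_right, real_inner_comm, hpj, norm_smul, hj, hp1,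
      Real.norm_eq_abs, mul_one, sq_abs]
    ring
  have hU : ∀ x ∈ U, 0 < 1 - ‖x‖ ^ 2 := by
    intro x hx
    have : ‖x‖ < 1 := by simpa [U] using hx
    nlinarith [norm_nonneg x]
  have hleft : ∀ x, (P.comp R) (φ x) = x := by
    intro x
    simp [hφ, hRL, hPj, hPp]
  have hsmooth : ContDiffOn ℝ ∞ φ U := by
    refine L.contDiff.comp_contDiffOn (j.contDiff.contDiffOn.add ?_)
    refine ContDiffOn.smul ?_ contDiffOn_const
    refine ContDiffOn.sqrt (contDiff_const.sub (contDiff_norm_sq ℝ)).contDiffOn ?_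
    intro x hx; exact (hU x hx).ne'
  have himage : φ '' U = L '' Metric.sphere 0 1 ∩ {z | 0 < inner ℝ p (R z)} := by
    ext z
    constructor
    · rintro ⟨x, hx, rfl⟩
      refine ⟨⟨_, ?_, rfl⟩, ?_⟩
      · have h2 : ‖j x + √(1 - ‖x‖ ^ 2) • p‖ ^ 2 = 1 := by
          rw [hnormsq, Real.sq_sqrt (hU x hx).le]
          ring
        have := (pow_eq_one_iff_of_nonneg (norm_nonneg _) two_ne_zero).1 h2
        simpa using this
      · simp only [hφ, mem_ofPred_eq, hRL, inner_add_right, hpj, inner_smul_right, hpp]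
        simpa using (hU x hx)
    · rintro ⟨⟨y, hy, rfl⟩, hy2⟩
      have hy1 : ‖y‖ = 1 := by simpa using hy
      simp only [mem_ofPred_eq, hRL] at hy2
      have hnorm : ‖P y‖ ^ 2 + inner ℝ p y ^ 2 = (1 : ℝ) := by
        have h2 : ‖j (P y) + inner ℝ p y • p‖ ^ 2 = 1 := by rw [hz, hy1]; norm_num
        rwa [hnormsq] at h2
      refine ⟨P y, ?_, ?_⟩
      · simp only [U, Metric.mem_ball, dist_zero_right]
        nlinarith [norm_nonneg (P y)]
      · have : √(1 - ‖P y‖ ^ 2) = inner ℝ p y := by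
          rw [show 1 - ‖P y‖ ^ 2 = inner ℝ p y ^ 2 by linarith, Real.sqrt_sq hy2.le]
        simp only [hφ, this, hz]
  refine ⟨U, φ, ⟨Metric.isOpen_ball, hsmooth, ?_, ?_, ?_⟩, ?_⟩
  · intro x hx
    have hd : DifferentiableAt ℝ φ x := (hsmooth.contDiffAt (Metric.isOpen_ball.mem_nhds hx)
      ).differentiableAt (by simp)
    have h1 : HasFDerivAt (fun y => (P.comp R) (φ y)) ((P.comp R).comp (fderiv ℝ φ x)) x :=
      (P.comp R).hasFDerivAt.comp x hd.hasFDerivAt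
    have h2 := h1.congr_of_eventuallyEq (f₁ := id) (Eventually.of_forall fun y => (hleft y).symm)
    have h3 := h2.unique (hasFDerivAt_id x)
    intro u v huv
    have := congrArg (P.comp R) huv
    have hu := DFunLike.congr_fun h3 u
    have hv := DFunLike.congr_fun h3 v
    simp only [ContinuousLinearMap.comp_apply, ContinuousLinearMap.id_apply] at hu hv this
    rw [← hu, ← hv, this]
  · refine IsEmbedding.of_comp hsmooth.continuousOn.domRestrict (P.comp R).continuous ?_
    have : (P.comp R) ∘ U.domRestrict φ = Subtype.val := funext fun y => hleft y
    rw [this]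
    exact IsEmbedding.subtypeVal
  · exact ⟨_, isOpen_lt continuous_const (continuous_const.inner R.continuous), himage⟩
  · rw [himage]
    refine ⟨⟨p, hp, rfl⟩, ?_⟩
    simp [hRL, hp1]

/-! ### Tangent vectors and covariant acceleration in local coordinates -/

/-- Every tangent vector lies in the range of the derivative of a local parametrization. -/
theorem IsLocalParametrization.exists_fderiv_eq {E : Type*} [NormedAddCommGroup E]
    [NormedSpace ℝ E] [FiniteDimensional ℝ E] {d : ℕ} {M : Set E}
    {U : Set (EuclideanSpace ℝ (Fin d))} {φ : EuclideanSpace ℝ (Fin d) → E}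
    (hφ : IsLocalParametrization M U φ) {x : EuclideanSpace ℝ (Fin d)} (hx : x ∈ U) {v : E}
    (hv : v ∈ tangentVectors M (φ x)) : ∃ w, fderiv ℝ φ x w = v := by
  classical
  obtain ⟨c, ε, hε, hc, hcM, hc0, hcv⟩ := hv
  have hI : Ioo (-ε) ε ∈ 𝓝 (0 : ℝ) := Ioo_mem_nhds (by linarith) hε
  have hcd : HasDerivAt c v 0 := by
    rw [← hcv]
    exact ((hc.contDiffAt hI).differentiableAt (by simp)).hasDerivAt
  obtain ⟨O, hO, hUO⟩ := hφ.relOpen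
  have hev : ∀ᶠ t in 𝓝 (0 : ℝ), c t ∈ φ '' U := by
    have hxO : c 0 ∈ O := by
      rw [hc0]
      exact (hUO.subset (mem_image_of_mem φ hx)).2
    filter_upwards [hI, hcd.continuousAt.preimage_mem_nhds (hO.mem_nhds hxO)] with t ht ht'
    rw [hUO]
    exact ⟨hcM t ht, ht'⟩
  have hinj : InjOn φ U := injOn_iff_injective.2 hφ.isEmbedding.injective
  -- The coordinate expression `φ⁻¹ ∘ c` of the curve. It is continuous because `φ` is an embedding;
  -- differentiability needs the inverse function theorem.
  let y : ℝ → EuclideanSpace ℝ (Fin d) := fun t => Function.invFunOn φ U (c t)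
  have hyU : ∀ᶠ t in 𝓝 (0 : ℝ), y t ∈ U ∧ φ (y t) = c t := by
    filter_upwards [hev] with t ht
    exact ⟨Function.invFunOn_mem ht, Function.invFunOn_eq ht⟩
  have hy0 : y 0 = x := by
    have := hyU.self_of_nhds
    exact hinj this.1 hx (this.2.trans hc0)
  have hycont : Tendsto y (𝓝 0) (𝓝 x) := by
    rw [← hy0]
    let y' : ℝ → U := fun t => if h : y t ∈ U then ⟨y t, h⟩ else ⟨x, hx⟩
    have hy' : ∀ᶠ t in 𝓝 (0 : ℝ), (y' t : EuclideanSpace ℝ (Fin d)) = y t := by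
      filter_upwards [hyU] with t ht
      simp [y', ht.1]
    have hy'c : ContinuousAt y' 0 := by
      rw [hφ.isEmbedding.continuousAt_iff]
      refine hcd.continuousAt.congr ?_
      filter_upwards [hyU, hy'] with t ht ht'
      simp [domRestrict, ht', ht.2]
    have := (continuous_subtype_val.continuousAt.comp hy'c).congr hy'
    exact this
  have hsm : ContDiffAt ℝ ∞ φ x := hφ.smooth.contDiffAt (hφ.isOpen.mem_nhds hx)
  -- With `L` a left inverse of `dφ_x`, the map `L ∘ φ` has derivative `id` at `x`. Near `0`, `y` is
  -- its local inverse applied to `L ∘ c`, hence differentiable there.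
  obtain ⟨g, hg⟩ := (fderiv ℝ φ x).toLinearMap.exists_leftInverse_of_injective
    (LinearMap.ker_eq_bot.2 (hφ.immersion x hx))
  let L : E →L[ℝ] EuclideanSpace ℝ (Fin d) := g.toContinuousLinearMap
  have hL : L.comp (fderiv ℝ φ x) = (ContinuousLinearEquiv.refl ℝ (EuclideanSpace ℝ (Fin d)) : _ →L[ℝ] _) := by
    ext1 u
    exact LinearMap.congr_fun hg u
  have hst : HasStrictFDerivAt (fun u => L (φ u))
      ((ContinuousLinearEquiv.refl ℝ (EuclideanSpace ℝ (Fin d)) : _ →L[ℝ] _)) x := by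
    rw [← hL]
    exact L.hasStrictFDerivAt.comp x (hsm.hasStrictFDerivAt (by simp))
  have hyd : HasDerivAt y (L v) 0 := by
    have h1 := hst.to_localInverse.hasFDerivAt
    rw [← hc0] at h1
    have h2 := h1.comp_hasDerivAt (0 : ℝ) (L.hasFDerivAt.comp_hasDerivAt (0 : ℝ) hcd)
    refine h2.congr_of_eventuallyEq ?_
    filter_upwards [hycont.eventually hst.eventually_left_inverse, hyU] with t ht ht'
    rw [← ht, ht'.2]
    rfl
  refine ⟨L v, ?_⟩
  have h3 : HasDerivAt (fun t => φ (y t)) (fderiv ℝ φ x (L v)) 0 := by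
    refine HasFDerivAt.comp_hasDerivAt (0 : ℝ) ?_ hyd
    rw [hy0]
    exact (hsm.differentiableAt (by simp)).hasFDerivAt
  refine (h3.congr_of_eventuallyEq ?_).unique hcd
  filter_upwards [hyU] with t ht
  exact ht.2.symm

/-- The Christoffel symbols of the metric induced by a constant symmetric form. -/
theorem christoffel_pullbackMetric_const {E F : Type*} [NormedAddCommGroup E] [NormedSpace ℝ E]
    [NormedAddCommGroup F] [NormedSpace ℝ F] (G : E →L[ℝ] E →L[ℝ] ℝ) (hG : ∀ u v, G u v = G v u)
    {φ : F → E} {x : F} (hφ : ContDiffAt ℝ ∞ φ x) (u w : F) :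
    christoffel (pullbackMetric φ fun _ => G) x u u w =
      G (fderiv ℝ (fderiv ℝ φ) x u u) (fderiv ℝ φ x w) := by
  have hd : DifferentiableAt ℝ (fderiv ℝ φ) x :=
    (hφ.fderiv_right (m := 1) (by norm_cast)).differentiableAt (by simp)
  have hsymm : ∀ a b, fderiv ℝ (fderiv ℝ φ) x a b = fderiv ℝ (fderiv ℝ φ) x b a :=
    fun a b => (hφ.isSymmSndFDerivAt (by simpa using (by norm_cast : (2 : ℕ∞ω) ≤ ∞))).eq a b
  have key : ∀ a b c, fderiv ℝ (fun y => pullbackMetric φ (fun _ => G) y a b) x c =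
      G (fderiv ℝ (fderiv ℝ φ) x c a) (fderiv ℝ φ x b) +
      G (fderiv ℝ φ x a) (fderiv ℝ (fderiv ℝ φ) x c b) := by
    intro a b c
    have ha := (hd.hasFDerivAt.clm_apply (hasFDerivAt_const a x))
    have hb := (hd.hasFDerivAt.clm_apply (hasFDerivAt_const b x))
    have := G.hasFDerivAt_of_bilinear ha hb
    have h2 := this.fderiv
    change fderiv ℝ (fun y => G (fderiv ℝ φ y a) (fderiv ℝ φ y b)) x c = _
    rw [h2]
    simp [add_comm]
  -- The terms `G(∂_u φ, ∂_u ∂_w φ)` cancel by symmetry of `G` and of the second derivative.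
  rw [christoffel, key, key, hsymm w u, hG (fderiv ℝ φ x u) (fderiv ℝ (fderiv ℝ φ) x u w)]
  ring

/-- The covariant acceleration in a submanifold with the induced metric is the tangential part of
the acceleration. -/
theorem lowerCovariantAcceleration_pullbackMetric_const {E F : Type*} [NormedAddCommGroup E]
    [NormedSpace ℝ E] [NormedAddCommGroup F] [NormedSpace ℝ F] (G : E →L[ℝ] E →L[ℝ] ℝ)
    (hG : ∀ u v, G u v = G v u) {φ : F → E} {x : ℝ → F} {γ : ℝ → E} {t : ℝ}
    (hφ : ContDiffAt ℝ ∞ φ (x t)) (hx : ContDiffAt ℝ ∞ x t) (hγ : ∀ᶠ s in 𝓝 t, φ (x s) = γ s)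
    (w : F) :
    deriv γ t = fderiv ℝ φ (x t) (deriv x t) ∧
    lowerCovariantAcceleration (pullbackMetric φ fun _ => G) x t w =
      G (deriv (deriv γ) t) (fderiv ℝ φ (x t) w) := by
  have hφd : ∀ᶠ s in 𝓝 t, DifferentiableAt ℝ φ (x s) := by
    refine hx.continuousAt.eventually ?_
    filter_upwards [(hφ.of_le (m := 1) (by norm_cast)).eventually (by simp)] with y hy
    exact hy.differentiableAt (by simp)
  have hxd : ∀ᶠ s in 𝓝 t, DifferentiableAt ℝ x s := by
    filter_upwards [(hx.of_le (m := 1) (by norm_cast)).eventually (by simp)] with y hy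
    exact hy.differentiableAt (by simp)
  have h1 : deriv γ =ᶠ[𝓝 t] fun s => fderiv ℝ φ (x s) (deriv x s) := by
    filter_upwards [hφd, hxd, hγ.eventually_nhds] with s h1 h2 h3
    have := h1.hasFDerivAt.comp_hasDerivAt s h2.hasDerivAt
    exact (this.congr_of_eventuallyEq (h3.mono fun _ h => h.symm)).deriv
  refine ⟨h1.self_of_nhds, ?_⟩
  have hd : DifferentiableAt ℝ (fderiv ℝ φ) (x t) :=
    (hφ.fderiv_right (m := 1) (by norm_cast)).differentiableAt (by simp)
  have hxdd : HasDerivAt (deriv x) (deriv (deriv x) t) t :=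
    ((ContDiffAt.derivWithin hx (m := 1) (by norm_cast)).differentiableAt (by simp)).hasDerivAt
  have h2 := (hd.hasFDerivAt.comp_hasDerivAt t hxd.self_of_nhds.hasDerivAt).clm_apply hxdd
  have h3 := (h2.congr_of_eventuallyEq h1).deriv
  rw [lowerCovariantAcceleration, christoffel_pullbackMetric_const G hG hφ, h3]
  simp [pullbackMetric, add_comm]

/-! ### The magnetic field -/

/-- The potential `α` as a linear map into the space of covectors. -/
noncomputable def magneticPotentialLinear (n : ℕ) : EuclideanSpace ℂ (Fin n) →ₗ[ℝ]
    EuclideanSpace ℂ (Fin n) [⋀^Fin 1]→L[ℝ] ℝ where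
  toFun := magneticPotential n
  map_add' u v := by
    ext w
    simp [magneticPotential]
  map_smul' c u := by
    ext w
    simp [magneticPotential, inner_smul_left_eq_smul]
    ring

theorem contDiff_magneticPotential (n : ℕ) : ContDiff ℝ ∞ (magneticPotential n) :=
  (magneticPotentialLinear n).toContinuousLinearMap.contDiff

/-- `α` is linear in `z`, so `dα(u, v) = ½ Im ⟨u, v⟩ - ½ Im ⟨v, u⟩`; antisymmetry of `Im ⟨·,·⟩`
absorbs the factor `½`. -/
theorem magneticField_apply (n : ℕ) (z : EuclideanSpace ℂ (Fin n))
    (v : Fin 2 → EuclideanSpace ℂ (Fin n)) : magneticField n z v = (inner ℂ (v 0) (v 1)).im := by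
  have hd : DifferentiableAt ℝ (magneticPotential n) z :=
    (contDiff_magneticPotential n).differentiable (by simp) z
  have hf : ∀ (w : Fin 1 → EuclideanSpace ℂ (Fin n)) u,
      fderiv ℝ (fun y => magneticPotential n y w) z u = (1 / 2 : ℝ) * (inner ℂ u (w 0)).im := by
    intro w u
    let f : EuclideanSpace ℂ (Fin n) →ₗ[ℝ] ℝ :=
      { toFun := fun y => magneticPotentialLinear n y w
        map_add' := by simp
        map_smul' := by simp }
    have := f.toContinuousLinearMap.hasFDerivAt (x := z)
    have h2 : HasFDerivAt (fun y => magneticPotential n y w) f.toContinuousLinearMap z := this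
    rw [h2.fderiv]
    change magneticPotential n u w = _
    simp [magneticPotential]
  rw [magneticField, extDeriv_apply hd, Fin.sum_univ_two, hf, hf]
  have h := congrArg Complex.im (inner_conj_symm (𝕜 := ℂ) (v 1) (v 0))
  rw [Complex.conj_im] at h
  simp only [Fin.removeNth, show Fin.succAbove (0 : Fin 2) 0 = 1 from rfl,
    show Fin.succAbove (1 : Fin 2) 0 = 0 from rfl, ← h]
  simp
  ring

theorem magneticField_eq_const (n : ℕ) : magneticField n = fun _ => magneticField n 0 := by
  funext z
  ext v
  rw [magneticField_apply, magneticField_apply]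

theorem euclideanMetric_apply (n : ℕ) (z u v : EuclideanSpace ℂ (Fin n)) :
    euclideanMetric n z u v = (inner ℂ u v).re := rfl

theorem extDeriv_magneticField (n : ℕ) (z : EuclideanSpace ℂ (Fin n)) :
    extDeriv (magneticField n) z = 0 :=
  extDeriv_extDeriv_apply (contDiff_magneticPotential n).contDiffAt
    (by simpa using (by norm_cast : (2 : ℕ∞ω) ≤ ∞))

/-! ### The ellipsoid and its linear sections -/

/-- The linear map `diag(r₁, …, rₙ)` on `ℂⁿ`. -/
noncomputable def coordScale {n : ℕ} (r : Fin n → ℝ) :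
    EuclideanSpace ℂ (Fin n) →ₗ[ℂ] EuclideanSpace ℂ (Fin n) where
  toFun z := WithLp.toLp 2 fun i => (r i : ℂ) * z i
  map_add' u v := by ext i; simp [mul_add]
  map_smul' c u := by ext i; simp; ring

@[simp]
theorem coordScale_apply {n : ℕ} (r : Fin n → ℝ) (z : EuclideanSpace ℂ (Fin n)) (i : Fin n) :
    coordScale r z i = r i * z i := rfl

theorem coordScale_coordScale_of_mul_eq_one {n : ℕ} {r s : Fin n → ℝ} (h : ∀ i, r i * s i = 1)
    (z : EuclideanSpace ℂ (Fin n)) : coordScale r (coordScale s z) = z := by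
  ext i
  rw [coordScale_apply, coordScale_apply, ← mul_assoc, ← Complex.ofReal_mul, h, Complex.ofReal_one,
    one_mul]

theorem coordScale_sqrt_mem_ellipsoid_iff {n : ℕ} {a : Fin n → ℝ} (ha : ∀ i, 0 < a i)
    (z : EuclideanSpace ℂ (Fin n)) :
    coordScale (fun i => √(a i)) z ∈ ellipsoid a ↔ ‖z‖ = 1 := by
  have : ∑ i, ‖coordScale (fun i => √(a i)) z i‖ ^ 2 / a i = ‖z‖ ^ 2 := by
    rw [EuclideanSpace.norm_sq_eq]
    refine Finset.sum_congr rfl fun i _ => ?_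
    rw [coordScale_apply, norm_mul, mul_pow, Complex.norm_real, Real.norm_eq_abs, sq_abs,
      Real.sq_sqrt (ha i).le, mul_div_cancel_left₀ _ (ha i).ne']
  rw [ellipsoid, mem_ofPred_eq, this]
  exact pow_eq_one_iff_of_nonneg (norm_nonneg _) two_ne_zero

theorem sqrt_mul_inv_sqrt {n : ℕ} {a : Fin n → ℝ} (ha : ∀ i, 0 < a i) (i : Fin n) :
    √(a i) * (√(a i))⁻¹ = 1 :=
  mul_inv_cancel₀ (Real.sqrt_pos.2 (ha i)).ne'

/-- Every ellipsoid is a linear image of the unit sphere. -/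
theorem ellipsoid_eq_image_sphere {n : ℕ} {a : Fin n → ℝ} (ha : ∀ i, 0 < a i) :
    ellipsoid a = coordScale (fun i => √(a i)) '' Metric.sphere 0 1 := by
  ext z
  constructor
  · intro hz
    rw [← coordScale_coordScale_of_mul_eq_one (sqrt_mul_inv_sqrt ha) z] at hz ⊢
    exact ⟨_, by simpa using (coordScale_sqrt_mem_ellipsoid_iff ha _).1 hz, rfl⟩
  · rintro ⟨y, hy, rfl⟩
    exact (coordScale_sqrt_mem_ellipsoid_iff ha y).2 (by simpa using hy)

theorem exists_isEmbeddedSubmanifold_image_sphere {E F : Type*} [NormedAddCommGroup E]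
    [NormedSpace ℝ E] [FiniteDimensional ℝ E] [NormedAddCommGroup F] [InnerProductSpace ℝ F]
    [FiniteDimensional ℝ F] (L : F →ₗ[ℝ] E) (hL : Function.Injective L) :
    ∃ d : ℕ, IsEmbeddedSubmanifold d (L '' Metric.sphere 0 1) := by
  obtain ⟨R, hR⟩ := L.exists_leftInverse_of_injective (LinearMap.ker_eq_bot.2 hL)
  rcases Nat.eq_zero_or_eq_succ_pred (Module.finrank ℝ F) with h | h
  -- The unit sphere of the zero space is empty. This covers the case that all `V_j` vanish.
  · have := Module.finrank_zero_iff.1 h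
    refine ⟨0, ?_⟩
    rintro _ ⟨y, hy, rfl⟩
    simp [Subsingleton.elim y 0] at hy
  · exact ⟨_, isEmbeddedSubmanifold_image_sphere h L.toContinuousLinearMap
      R.toContinuousLinearMap fun x => LinearMap.congr_fun hR x⟩

/-- The section is the image of the unit sphere of the subspace `S⁻¹(W)`. -/
theorem exists_isEmbeddedSubmanifold_image_sphere_inter {E F : Type*} [NormedAddCommGroup E]
    [NormedSpace ℝ E] [FiniteDimensional ℝ E] [NormedAddCommGroup F] [InnerProductSpace ℝ F]
    [FiniteDimensional ℝ F] (S : F →ₗ[ℝ] E) (hS : Function.Injective S) (W : Submodule ℝ E) :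
    ∃ d : ℕ, IsEmbeddedSubmanifold d (S '' Metric.sphere 0 1 ∩ W) := by
  have himage : S '' Metric.sphere 0 1 ∩ W =
      (S ∘ₗ (W.comap S).subtype) '' Metric.sphere 0 1 := by
    ext z
    constructor
    · rintro ⟨⟨y, hy, rfl⟩, hW⟩
      exact ⟨⟨y, hW⟩, by simpa using hy, rfl⟩
    · rintro ⟨⟨y, hW⟩, hy, rfl⟩
      exact ⟨⟨y, by simpa using hy, rfl⟩, hW⟩
  rw [himage]
  exact exists_isEmbeddedSubmanifold_image_sphere _ (hS.comp Subtype.val_injective)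

/-- Linear sections of ellipsoids are embedded submanifolds. -/
theorem exists_isEmbeddedSubmanifold_ellipsoid_inter {n : ℕ} {a : Fin n → ℝ} (ha : ∀ i, 0 < a i)
    (W : Submodule ℝ (EuclideanSpace ℂ (Fin n))) :
    ∃ d : ℕ, IsEmbeddedSubmanifold d (ellipsoid a ∩ W) := by
  rw [ellipsoid_eq_image_sphere ha]
  refine exists_isEmbeddedSubmanifold_image_sphere_inter
    ((coordScale fun i => √(a i)).restrictScalars ℝ) ?_ W
  refine Function.LeftInverse.injective (g := coordScale fun i => (√(a i))⁻¹) fun z => ?_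
  exact coordScale_coordScale_of_mul_eq_one
    (fun i => (mul_comm _ _).trans (sqrt_mul_inv_sqrt ha i)) z

theorem isMagneticSystem_ellipsoid {n : ℕ} (hn : 1 ≤ n) {a : Fin n → ℝ} (ha : ∀ i, 0 < a i) :
    IsMagneticSystem (ellipsoid a) (euclideanMetric n) (magneticField n) where
  submanifold := by
    simpa using exists_isEmbeddedSubmanifold_ellipsoid_inter ha ⊤
  compact := by
    rw [ellipsoid_eq_image_sphere ha]
    exact (isCompact_sphere 0 1).image (LinearMap.continuous_of_finiteDimensional _)
  connected := by
    rw [ellipsoid_eq_image_sphere ha]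
    refine (isConnected_sphere ?_ 0 zero_le_one).image _
      (LinearMap.continuous_of_finiteDimensional _).continuousOn
    -- The unit sphere is connected because the real dimension `2n` exceeds `1`.
    have : Module.finrank ℝ (EuclideanSpace ℂ (Fin n)) = 2 * n := by
      rw [finrank_real_of_complex, finrank_euclideanSpace_fin]
    rw [← Module.finrank_eq_rank, this]
    exact_mod_cast (by omega : 1 < 2 * n)
  metric_smooth := contDiff_const
  metric_symm p u v := by
    rw [euclideanMetric_apply, euclideanMetric_apply, ← inner_conj_symm, Complex.conj_re]
  metric_pos p _ v _ hv := by
    rw [euclideanMetric_apply]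
    rw [show (inner ℂ v v).re = ‖v‖ ^ 2 from inner_self_eq_norm_sq (𝕜 := ℂ) v]
    have := norm_pos_iff.2 hv
    positivity
  form_smooth := by
    rw [magneticField_eq_const]
    exact contDiff_const
  form_closed := extDeriv_magneticField n

/-! ### The equation of motion -/

/-- Vectors orthogonal to the normal direction are tangent to the ellipsoid. -/
theorem mem_tangentVectors_ellipsoid {n : ℕ} {a : Fin n → ℝ} (ha : ∀ i, 0 < a i)
    {p v : EuclideanSpace ℂ (Fin n)} (hp : p ∈ ellipsoid a)
    (hv : (inner ℂ (coordScale (fun i => (a i)⁻¹) p) v).re = 0) :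
    v ∈ tangentVectors (ellipsoid a) p := by
  set s := ∑ i, ‖v i‖ ^ 2 / a i with hs
  have hs0 : 0 ≤ s := Finset.sum_nonneg fun i _ => div_nonneg (sq_nonneg _) (ha i).le
  have hpos : ∀ t : ℝ, 0 < 1 + t ^ 2 * s := fun t => by positivity
  -- The cross term is `2t Re ⟨A⁻¹ p, v⟩ = 0`. The line `p + t v` thus leaves the ellipsoid only to
  -- second order, and rescaling it back does not change its velocity at `0`.
  have hq : ∀ t : ℝ, ∑ i, ‖(p + t • v) i‖ ^ 2 / a i = 1 + t ^ 2 * s := by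
    intro t
    have hp' : ∑ i, ‖p i‖ ^ 2 / a i = 1 := hp
    have hv' : ∑ i, (a i)⁻¹ * ((p i).re * (v i).re + (p i).im * (v i).im) = 0 := by
      rw [← hv, PiLp.inner_apply, Complex.re_sum]
      refine Finset.sum_congr rfl fun i _ => ?_
      simp [coordScale_apply]
      ring
    have hv2 := congrArg (fun r => 2 * t * r) hv'
    simp only [mul_zero] at hv2
    rw [← hp', hs, ← add_zero (∑ i, ‖p i‖ ^ 2 / a i), ← hv2, Finset.mul_sum, Finset.mul_sum,
      ← Finset.sum_add_distrib, ← Finset.sum_add_distrib]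
    refine Finset.sum_congr rfl fun i _ => ?_
    simp only [PiLp.add_apply, PiLp.smul_apply, Complex.sq_norm, Complex.normSq_apply,
      Complex.add_re, Complex.add_im, Complex.real_smul, Complex.re_ofReal_mul,
      Complex.im_ofReal_mul]
    ring
  have hcs : ContDiff ℝ ∞ fun t : ℝ => (√(1 + t ^ 2 * s))⁻¹ • (p + t • v) := by
    refine ContDiff.smul (ContDiff.inv (ContDiff.sqrt (by fun_prop) fun t => (hpos t).ne')
      fun t => (Real.sqrt_pos.2 (hpos t)).ne') (by fun_prop)
  refine ⟨fun t => (√(1 + t ^ 2 * s))⁻¹ • (p + t • v), 1, one_pos, hcs.contDiffOn, ?_, by simp, ?_⟩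
  · intro t _
    have : ∀ i, ‖((√(1 + t ^ 2 * s))⁻¹ • (p + t • v)) i‖ ^ 2 / a i =
        (1 + t ^ 2 * s)⁻¹ * (‖(p + t • v) i‖ ^ 2 / a i) := by
      intro i
      rw [PiLp.smul_apply, norm_smul, mul_pow, Real.norm_eq_abs, sq_abs, inv_pow,
        Real.sq_sqrt (hpos t).le, mul_div_assoc]
    rw [ellipsoid, mem_ofPred_eq, Finset.sum_congr rfl fun i _ => this i, ← Finset.mul_sum, hq,
      inv_mul_cancel₀ (hpos t).ne']
  · have h1 : HasDerivAt (fun t : ℝ => 1 + t ^ 2 * s) 0 0 := by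
      simpa using (((hasDerivAt_id (0 : ℝ)).pow 2).mul_const s).const_add 1
    have h2 := (h1.sqrt (hpos 0).ne').inv (Real.sqrt_pos.2 (hpos 0)).ne'
    have h3 := h2.smul (((hasDerivAt_id (0 : ℝ)).smul_const v).const_add p)
    exact (h3.congr_deriv (by simp [Pi.inv_apply])).deriv

/-- The normal vector of the ellipsoid does not vanish. -/
theorem coordScale_inv_ne_zero {n : ℕ} {a : Fin n → ℝ} (ha : ∀ i, 0 < a i)
    {p : EuclideanSpace ℂ (Fin n)} (hp : p ∈ ellipsoid a) :
    coordScale (fun i => (a i)⁻¹) p ≠ 0 := by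
  intro h
  have h0 : p = 0 := by
    rw [← coordScale_coordScale_of_mul_eq_one (fun i => mul_inv_cancel₀ (ha i).ne') p, h, map_zero]
  simp [ellipsoid, h0] at hp

/-- The tangential part of the acceleration of a magnetic geodesic of the ellipsoid. -/
theorem IsMagneticGeodesic.inner_acceleration {n : ℕ} {a : Fin n → ℝ} (ha : ∀ i, 0 < a i)
    {I : Set ℝ} {γ : ℝ → EuclideanSpace ℂ (Fin n)}
    (hγ : IsMagneticGeodesic (ellipsoid a) (euclideanMetric n) (magneticField n) I γ)
    {t : ℝ} (ht : t ∈ I) {v : EuclideanSpace ℂ (Fin n)}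
    (hv : (inner ℂ (coordScale (fun i => (a i)⁻¹) (γ t)) v).re = 0) :
    (inner ℂ (deriv (deriv γ) t - Complex.I • deriv γ t) v).re = 0 := by
  obtain ⟨d, U, φ, J, x, hφ, hJ, htJ, hJI, hx, hxγ, heq⟩ := hγ.equation t ht
  have hvt := mem_tangentVectors_ellipsoid ha (hγ.mapsTo ht) hv
  rw [← (hxγ t htJ).2] at hvt
  obtain ⟨w, rfl⟩ := hφ.exists_fderiv_eq (hxγ t htJ).1 hvt
  have h1 := lowerCovariantAcceleration_pullbackMetric_const (γ := γ) (euclideanMetric n 0)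
    ((isMagneticSystem_ellipsoid (Fin.pos_iff_nonempty.2 ?_) ha).metric_symm 0)
    (hφ.smooth.contDiffAt (hφ.isOpen.mem_nhds (hxγ t htJ).1)) (hx.contDiffAt (hJ.mem_nhds htJ))
    (by filter_upwards [hJ.mem_nhds htJ] with s hs using (hxγ s hs).2) w
  · have h2 := heq t htJ w
    change lowerCovariantAcceleration (pullbackMetric φ fun _ => euclideanMetric n 0) x t w = _ at h2
    rw [h1.2, euclideanMetric_apply, pullbackTwoForm,
      ContinuousAlternatingMap.compContinuousLinearMap_apply, magneticField_apply] at h2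
    simp only [Function.comp_apply, Matrix.cons_val_zero, Matrix.cons_val_one, ← h1.1] at h2
    -- Conjugate-linearity in the first argument gives `Re ⟨i γ̇, v⟩ = Im ⟨γ̇, v⟩`.
    rw [inner_sub_left, inner_smul_left, Complex.sub_re, h2]
    simp
  · by_contra hne
    rw [not_nonempty_iff] at hne
    exact coordScale_inv_ne_zero ha (hγ.mapsTo ht) (Subsingleton.elim _ _)

/-- The multiplier of the normal component of the acceleration. -/
noncomputable def normalMultiplier {n : ℕ} (a : Fin n → ℝ) (γ : ℝ → EuclideanSpace ℂ (Fin n)) (t : ℝ) : ℝ :=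
  (inner ℂ (coordScale (fun i => (a i)⁻¹) (γ t))
    (deriv (deriv γ) t - Complex.I • deriv γ t)).re / ‖coordScale (fun i => (a i)⁻¹) (γ t)‖ ^ 2

/-- Magnetic geodesics of the ellipsoid solve `γ̈ = i γ̇ + μ A⁻¹ γ`. -/
theorem IsMagneticGeodesic.deriv_deriv_eq {n : ℕ} {a : Fin n → ℝ} (ha : ∀ i, 0 < a i)
    {I : Set ℝ} {γ : ℝ → EuclideanSpace ℂ (Fin n)}
    (hγ : IsMagneticGeodesic (ellipsoid a) (euclideanMetric n) (magneticField n) I γ)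
    {t : ℝ} (ht : t ∈ I) :
    deriv (deriv γ) t = Complex.I • deriv γ t +
      (normalMultiplier a γ t : ℂ) • coordScale (fun i => (a i)⁻¹) (γ t) := by
  set ν := coordScale (fun i => (a i)⁻¹) (γ t) with hν
  set u := deriv (deriv γ) t - Complex.I • deriv γ t with hu
  have hν0 : ‖ν‖ ^ 2 ≠ 0 := pow_ne_zero 2 (norm_ne_zero_iff.2
    (coordScale_inv_ne_zero ha (hγ.mapsTo ht)))
  have hμ : normalMultiplier a γ t = (inner ℂ ν u).re / ‖ν‖ ^ 2 := rfl
  set c := normalMultiplier a γ t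
  have hnorm : ∀ z : EuclideanSpace ℂ (Fin n), (inner ℂ z z).re = ‖z‖ ^ 2 :=
    fun z => inner_self_eq_norm_sq (𝕜 := ℂ) z
  -- The tangential part `u - c ν` is itself an admissible test vector. It is orthogonal to `u` by
  -- the equation and to `ν` by the choice of `c`, hence to itself.
  have h1 : (inner ℂ ν (u - (c : ℂ) • ν)).re = 0 := by
    rw [inner_sub_right, inner_smul_right, Complex.sub_re, Complex.re_ofReal_mul, hnorm, hμ,
      div_mul_cancel₀ _ hν0, sub_self]
  have h2 := hγ.inner_acceleration ha ht h1
  have h3 : u - (c : ℂ) • ν = 0 := by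
    have : ‖u - (c : ℂ) • ν‖ ^ 2 = 0 := by
      rw [← hnorm]
      nth_rw 1 [inner_sub_left]
      rw [inner_smul_left, Complex.conj_ofReal, Complex.sub_re, Complex.re_ofReal_mul, h1, h2]
      simp
    simpa using this
  rw [← sub_eq_zero, ← h3, hu]
  abel

/-- Continuity bounds the coefficient of the linear equation on compact intervals, as the uniqueness
argument requires. -/
theorem IsMagneticGeodesic.continuousOn_normalMultiplier {n : ℕ} {a : Fin n → ℝ}
    (ha : ∀ i, 0 < a i) {I : Set ℝ} (hI : IsOpen I) {γ : ℝ → EuclideanSpace ℂ (Fin n)}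
    (hγ : IsMagneticGeodesic (ellipsoid a) (euclideanMetric n) (magneticField n) I γ) :
    ContinuousOn (normalMultiplier a γ) I := by
  have h1 : ContDiffOn ℝ ∞ (deriv γ) I := hγ.smooth.deriv_of_isOpen hI (by norm_cast)
  have h2 : ContDiffOn ℝ ∞ (deriv (deriv γ)) I := h1.deriv_of_isOpen hI (by norm_cast)
  have hB : ContinuousOn (fun t => coordScale (fun i => (a i)⁻¹) (γ t)) I :=
    (LinearMap.continuous_of_finiteDimensional _).comp_continuousOn hγ.smooth.continuousOn
  refine ContinuousOn.div ?_ (hB.norm.pow 2) fun t ht => pow_ne_zero 2 (norm_ne_zero_iff.2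
    (coordScale_inv_ne_zero ha (hγ.mapsTo ht)))
  exact Complex.continuous_re.comp_continuousOn ((continuous_inner (𝕜 := ℂ)).comp_continuousOn
    (hB.prodMk (h2.continuousOn.sub (h1.continuousOn.const_smul Complex.I))))

/-! ### Uniqueness for the scalar equation -/

/-- Uniqueness for `y'' = i y' + m y` with vanishing initial data. -/
theorem eq_zero_of_second_order_linear_ode {ε : ℝ} (hε : 0 < ε) {m : ℝ → ℂ}
    (hm : ContinuousOn m (Icc (-ε) ε)) {y z : ℝ → ℂ}
    (hy : ∀ t ∈ Ioo (-ε) ε, HasDerivAt y (z t) t)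
    (hz : ∀ t ∈ Ioo (-ε) ε, HasDerivAt z (Complex.I * z t + m t * y t) t)
    (hy0 : y 0 = 0) (hz0 : z 0 = 0) : ∀ t ∈ Ioo (-ε) ε, y t = 0 := by
  obtain ⟨C, hC⟩ := isCompact_Icc.exists_bound_of_continuousOn hm
  -- The first-order system for `(y, z)` with `z = y'`. In the sup norm on `ℂ × ℂ`, the operator
  -- norm is at most `1 + C`: `1` from `i z` and `C` from `m y`.
  let T : ℝ → ℂ × ℂ →L[ℝ] ℂ × ℂ := fun t =>
    (ContinuousLinearMap.snd ℝ ℂ ℂ).prod (Complex.I • ContinuousLinearMap.snd ℝ ℂ ℂ +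
      m t • ContinuousLinearMap.fst ℝ ℂ ℂ)
  have hT : ∀ t ∈ Ioo (-ε) ε, LipschitzOnWith (1 + C).toNNReal (T t) univ := by
    intro t ht
    have hCt := hC t (Ioo_subset_Icc_self ht)
    have hC0 : 0 ≤ C := (norm_nonneg _).trans hCt
    refine ((T t).lipschitz.weaken ?_).lipschitzOnWith
    rw [← NNReal.coe_le_coe, coe_nnnorm, Real.coe_toNNReal _ (by linarith)]
    refine (T t).opNorm_le_bound (by linarith) fun w => ?_
    have h1 : ‖w.1‖ ≤ ‖w‖ := norm_fst_le w
    have h2 : ‖w.2‖ ≤ ‖w‖ := norm_snd_le w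
    have h0 := norm_nonneg w
    refine norm_prod_le_iff.2 ⟨?_, ?_⟩
    · change ‖w.2‖ ≤ _
      nlinarith
    · change ‖Complex.I * w.2 + m t * w.1‖ ≤ _
      refine (norm_add_le _ _).trans ?_
      rw [norm_mul, norm_mul, Complex.norm_I]
      nlinarith [mul_le_mul hCt h1 (norm_nonneg _) hC0]
  have h := ODE_solution_unique_of_mem_Ioo (v := fun t => T t) (s := fun _ => univ)
    (f := fun t => (y t, z t)) (g := fun _ => 0) (t₀ := 0) hT ⟨by linarith, hε⟩
    (fun t ht => ⟨(hy t ht).prodMk (hz t ht), mem_univ _⟩)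
    (fun t _ => ⟨by simpa using hasDerivAt_const t (0 : ℂ × ℂ), mem_univ _⟩) (by simp [hy0, hz0])
  exact fun t ht => congrArg Prod.fst (h ht)

/-! ### Eigenspace blocks and conclusion -/

/-- `coordBlock` as a linear map. -/
noncomputable def coordBlockLinear {n : ℕ} (a : Fin n → ℝ) (c : ℝ) {l : ℕ}
    (hl : (Finset.univ.filter fun i => a i = c).card = l) :
    EuclideanSpace ℂ (Fin n) →ₗ[ℂ] EuclideanSpace ℂ (Fin l) where
  toFun := coordBlock a c hl
  map_add' _ _ := rfl
  map_smul' _ _ := rfl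

/-- The eigenspace property of the blocks. -/
theorem coordBlockLinear_coordScale_inv {n : ℕ} (a : Fin n → ℝ) (c : ℝ) {l : ℕ}
    (hl : (Finset.univ.filter fun i => a i = c).card = l) (z : EuclideanSpace ℂ (Fin n)) :
    coordBlockLinear a c hl (coordScale (fun i => (a i)⁻¹) z) =
      ((c⁻¹ : ℝ) : ℂ) • coordBlockLinear a c hl z := by
  ext m
  have hm := Finset.orderEmbOfFin_mem _ hl m
  rw [Finset.mem_filter] at hm
  change ((a _)⁻¹ : ℝ) * _ = ((c⁻¹ : ℝ) : ℂ) * _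
  rw [hm.2]
  rfl

/-- A complex linear eigenfunctional of `A⁻¹` which vanishes to first order along a magnetic
geodesic of the ellipsoid vanishes along it. -/
theorem IsMagneticGeodesic.eigenfunctional_eq_zero {n : ℕ} {a : Fin n → ℝ} (ha : ∀ i, 0 < a i)
    {I : Set ℝ} (hI : IsOpen I) {γ : ℝ → EuclideanSpace ℂ (Fin n)}
    (hγ : IsMagneticGeodesic (ellipsoid a) (euclideanMetric n) (magneticField n) I γ)
    {f : EuclideanSpace ℂ (Fin n) →ₗ[ℂ] ℂ} {c : ℂ}
    (hf : ∀ z, f (coordScale (fun i => (a i)⁻¹) z) = c * f z) {ε : ℝ} (hε : 0 < ε)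
    (hεI : Icc (-ε) ε ⊆ I) (h0 : f (γ 0) = 0) (h1 : f (deriv γ 0) = 0) :
    ∀ t ∈ Ioo (-ε) ε, f (γ t) = 0 := by
  have hs1 : ContDiffOn ℝ ∞ (deriv γ) I := hγ.smooth.deriv_of_isOpen hI (by norm_cast)
  let F : EuclideanSpace ℂ (Fin n) →L[ℝ] ℂ := (f.restrictScalars ℝ).toContinuousLinearMap
  have hd : ∀ {g : ℝ → EuclideanSpace ℂ (Fin n)}, ContDiffOn ℝ ∞ g I → ∀ t ∈ Ioo (-ε) ε,
      HasDerivAt (fun s => f (g s)) (f (deriv g t)) t := fun hg t ht =>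
    F.hasFDerivAt.comp_hasDerivAt t (((hg.contDiffAt
      (hI.mem_nhds (hεI (Ioo_subset_Icc_self ht)))).differentiableAt (by simp)).hasDerivAt)
  refine eq_zero_of_second_order_linear_ode hε (m := fun t => (normalMultiplier a γ t : ℂ) * c)
    ?_ (hd hγ.smooth) (fun t ht => ?_) h0 h1
  · exact (Complex.continuous_ofReal.comp_continuousOn
      ((hγ.continuousOn_normalMultiplier ha hI).mono hεI)).mul continuousOn_const
  · have := hd hs1 t ht
    rw [hγ.deriv_deriv_eq ha (hεI (Ioo_subset_Icc_self ht)), map_add, map_smul, map_smul, hf,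
      smul_eq_mul, smul_eq_mul, ← mul_assoc] at this
    exact this

/-- `blockSum` as a complex linear subspace. -/
noncomputable def blockSumSubmodule {n k : ℕ} (a : Fin n → ℝ) (lam : Fin k → ℝ) {l : Fin k → ℕ}
    (hl : ∀ j, (Finset.univ.filter fun i => a i = lam j).card = l j)
    (V : (j : Fin k) → Submodule ℂ (EuclideanSpace ℂ (Fin (l j)))) :
    Submodule ℂ (EuclideanSpace ℂ (Fin n)) :=
  ⨅ j, (V j).comap (coordBlockLinear a (lam j) (hl j))

theorem coe_blockSumSubmodule {n k : ℕ} (a : Fin n → ℝ) (lam : Fin k → ℝ) {l : Fin k → ℕ}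
    (hl : ∀ j, (Finset.univ.filter fun i => a i = lam j).card = l j)
    (V : (j : Fin k) → Submodule ℂ (EuclideanSpace ℂ (Fin (l j)))) :
    (blockSumSubmodule a lam hl V : Set (EuclideanSpace ℂ (Fin n))) = blockSum a lam hl V := by
  ext z
  simp only [blockSumSubmodule, SetLike.mem_coe, Submodule.mem_iInf, Submodule.mem_comap]
  rfl

/-- Tangent vectors of a subset of the kernel of a functional lie in that kernel. -/
theorem map_eq_zero_of_mem_tangentVectors {E G : Type*} [NormedAddCommGroup E] [NormedSpace ℝ E]
    [NormedAddCommGroup G] [NormedSpace ℝ G] {N : Set E} {p v : E}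
    (F : E →L[ℝ] G) (hF : ∀ z ∈ N, F z = 0) (hv : v ∈ tangentVectors N p) : F v = 0 := by
  obtain ⟨c, ε, hε, hc, hcN, -, rfl⟩ := hv
  have hI : Ioo (-ε) ε ∈ 𝓝 (0 : ℝ) := Ioo_mem_nhds (by linarith) hε
  have h1 := F.hasFDerivAt.comp_hasDerivAt (0 : ℝ)
    ((hc.contDiffAt hI).differentiableAt (by simp)).hasDerivAt
  refine h1.unique ((hasDerivAt_const (0 : ℝ) (0 : G)).congr_of_eventuallyEq ?_)
  filter_upwards [hI] with t ht
  exact hF _ (hcN t ht)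

/-- `0 < a₁ ≤ ⋯ ≤ aₙ`, with distinct values `λ₁ < ⋯ < λ_k` of multiplicities `ℓ₁, …, ℓ_k`. -/
theorem mainTheorem8 {n : ℕ} (hn : 1 ≤ n) (a : Fin n → ℝ) (ha_pos : ∀ i, 0 < a i)
    (ha_mono : Monotone a) {k : ℕ} (lam : Fin k → ℝ) (hlam : StrictMono lam)
    (hlam_range : Set.range lam = Set.range a) (l : Fin k → ℕ)
    (hl : ∀ j, (Finset.univ.filter fun i => a i = lam j).card = l j)
    (V : (j : Fin k) → Submodule ℂ (EuclideanSpace ℂ (Fin (l j)))) :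
    IsTotallyMagnetic (ellipsoid a) (euclideanMetric n) (magneticField n)
      (ellipsoid a ∩ blockSum a lam hl V) := by
  refine ⟨isMagneticSystem_ellipsoid hn ha_pos, inter_subset_left, ?_, ?_⟩
  · rw [← coe_blockSumSubmodule]
    exact exists_isEmbeddedSubmanifold_ellipsoid_inter ha_pos
      ((blockSumSubmodule a lam hl V).restrictScalars ℝ)
  · intro I γ hI _ h0I hγ hγ0 hγ1
    -- A closed interval inside `I`, so that the multiplier is bounded on it.
    obtain ⟨ε, hε, hεI⟩ := Metric.nhds_basis_closedBall.mem_iff.1 (hI.mem_nhds h0I)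
    rw [Real.closedBall_eq_Icc, zero_sub, zero_add] at hεI
    refine ⟨ε, hε, Ioo_subset_Icc_self.trans hεI, fun t ht =>
      ⟨hγ.mapsTo (hεI (Ioo_subset_Icc_self ht)), fun j => ?_⟩⟩
    by_contra hj
    -- A functional on the block that kills `V j` but not the block of `γ t`. Its composition with
    -- the block projection is an eigenfunctional of `A⁻¹` for `λ_j⁻¹`.
    obtain ⟨f, hfj, hfV⟩ := Submodule.exists_le_ker_of_notMem hj
    let g := f ∘ₗ coordBlockLinear a (lam j) (hl j)
    have hg : ∀ z ∈ ellipsoid a ∩ blockSum a lam hl V, g z = 0 := fun z hz => hfV (hz.2 j)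
    refine hfj (hγ.eigenfunctional_eq_zero ha_pos hI (f := g) (c := (((lam j)⁻¹ : ℝ) : ℂ)) ?_ hε hεI
      (hg _ hγ0) ?_ t ht)
    · intro z
      simp only [g, LinearMap.comp_apply, coordBlockLinear_coordScale_inv, map_smul, smul_eq_mul]
    · exact map_eq_zero_of_mem_tangentVectors
        (g.restrictScalars ℝ).toContinuousLinearMap hg hγ1
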